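/- There is an absolute constant $C>0$ such that the following holds for all integers $k\ge 1$, all reals $G\ge 0$, and every kernel $f:[k]\times[k]\to\mathbb{R}$ that is $G$-Lipschitz in each argument, i.e. $|f(i,j)-f(i,j')|\le G|j-j'|$ and $|f(i,j)-f(i',j)|\le G|i-i'|$ for all $i,i',j,j'\in[k]$. Write $W^f\in\mathbb{R}^{k\times k}$ for the matrix with entries $W^f_{i,j}=f(i,j)$; for a real matrix $A$ let $\|A\|_{1\to 2}$ be the largest Euclidean norm of a column of $A$; and let $\gamma_2(W)=\min_{L^{T}R=W}\|L\|_{1\to2}\|R\|_{1\to2}$, where $L,R\in\mathbb{R}^{d\times k}$ and $d$ is arbitrary. 1. If $|f(i,j)|\le Gk$ for all $i,j$, then $\gamma_2(W^f)\le C\,Gk$. Moreover, without this normalization, there is a constant $c\in\mathbb{R}$ such that $|f(i,j)-c|\le Gk$ for all $i,j$ and $\gamma_2(W^{f-c})\le C\,Gk$. 2. If $f$ is symmetric, then for every $n\ge 2$ and every $\varepsilon>0$ there is a non-interactive $\varepsilon$-local-DP protocol (without public randomness) for $n$ users with inputs $x_1,\dots,x_n\in[k]$ which, on every input, estimates the pairwise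 statistic $\binom{n}{2}^{-1}\sum_{1\le a<b\le n}f(x_a,x_b)$ with mean squared error at most $C\,\dfrac{G^2k^2\log k}{\varepsilon^2 n}$. Here each user $a$ sends a single message drawn, independently of the other users, from a distribution $\mathcal{R}(x_a)$ that depends only on $x_a$, where $\Pr[\mathcal{R}(v)\in S]\le e^{\varepsilon}\Pr[\mathcal{R}(v')\in S]$ for all $v,v'\in[k]$ and all measurable $S$; and the analyst outputs a real-valued function of the $n$ messages. -/

import Mathlib

open MeasureTheory

noncomputable section

namespace PairwiseLDP

/-! ### Factorization norm -/

/-- The `1 → 2` norm of a real matrix: the largest Euclidean norm of a column. -/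
def oneTwoNorm {d k : ℕ} (A : Matrix (Fin d) (Fin k) ℝ) : ℝ :=
  ⨆ j : Fin k, Real.sqrt (∑ i : Fin d, A i j ^ 2)

/-- The factorization norm `γ₂(W)`, the least value of `‖L‖₁→₂ ‖R‖₁→₂` over all
factorizations `Lᵀ R = W` with any number `d` of rows. -/
def gammaTwo {k : ℕ} (W : Matrix (Fin k) (Fin k) ℝ) : ℝ :=
  sInf {r : ℝ | ∃ (d : ℕ) (L R : Matrix (Fin d) (Fin k) ℝ),
    L.transpose * R = W ∧ r = oneTwoNorm L * oneTwoNorm R}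

/-! ### Kernels on `[k]` and pairwise statistics -/

/-- The matrix `W^f` of a kernel `f` on `[k]`. -/
def kernelMatrix {k : ℕ} (f : Fin k → Fin k → ℝ) : Matrix (Fin k) (Fin k) ℝ :=
  Matrix.of f

/-- `f` is symmetric. -/
def IsSymmKernel {k : ℕ} (f : Fin k → Fin k → ℝ) : Prop :=
  ∀ i j, f i j = f j i

/-- `f` is `G`-Lipschitz in each of its two arguments, for the distance `|i - j|` on `[k]`. -/
def IsLipschitzKernel {k : ℕ} (G : ℝ) (f : Fin k → Fin k → ℝ) : Prop :=
  (∀ i j j', |f i j - f i j'| ≤ G * |(j : ℝ) - (j' : ℝ)|) ∧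
  (∀ i i' j, |f i j - f i' j| ≤ G * |(i : ℝ) - (i' : ℝ)|)

/-- The pairwise statistic `(n choose 2)⁻¹ ∑_{a < b} f (x a) (x b)`. -/
def pairwiseStatistic {k n : ℕ} (f : Fin k → Fin k → ℝ) (x : Fin n → Fin k) : ℝ :=
  ((n.choose 2 : ℕ) : ℝ)⁻¹ *
    ∑ p ∈ Finset.univ.filter (fun p : Fin n × Fin n => p.1 < p.2), f (x p.1) (x p.2)

/-! ### Non-interactive local protocols -/

/-- A non-interactive protocol, without public randomness, for `n` users with inputs in `[k]`:
each user applies the randomizer to its own input, with its own independent random coins, and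
sends the single resulting message; the analyst turns the `n` messages into a real estimate. -/
structure Protocol (k n : ℕ) where
  /-- The space of messages. -/
  Msg : Type
  [msgMeasurable : MeasurableSpace Msg]
  /-- The distribution of the message of a user with the given input. -/
  randomizer : Fin k → Measure Msg
  randomizer_prob : ∀ v, IsProbabilityMeasure (randomizer v)
  /-- The output of the analyst. -/
  estimate : (Fin n → Msg) → ℝ
  estimate_measurable : Measurable estimate

attribute [instance] Protocol.msgMeasurable Protocol.randomizer_prob

namespace Protocol

variable {k n : ℕ}

/-- `ε`-local differential privacy: the message of a user is `ε`-indistinguishable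
under any change of the input of that user. -/
def IsLocalDP (P : Protocol k n) (ε : ℝ) : Prop :=
  ∀ (v v' : Fin k) (S : Set P.Msg), MeasurableSet S →
    P.randomizer v S ≤ ENNReal.ofReal (Real.exp ε) * P.randomizer v' S

/-- The joint law of the `n` independent messages on the input `x`. -/
def transcript (P : Protocol k n) (x : Fin n → Fin k) : Measure (Fin n → P.Msg) :=
  Measure.pi fun a => P.randomizer (x a)

/-- The mean squared error, as an estimate of `z`, of the output on the input `x`. -/
def mse (P : Protocol k n) (x : Fin n → Fin k) (z : ℝ) : ENNReal :=
  ∫⁻ y, ENNReal.ofReal ((P.estimate y - z) ^ 2) ∂(P.transcript x)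

end Protocol

end PairwiseLDP

end

/-! Both parts rest on dyadic chaining. A point is approximated by representatives at scales `k / 2
^ t`, and a function of it is telescoped into increments along these levels (`apply_rep_eq`). With
`B = G * k`, a Lipschitz function has at most `2 ^ (t + 1)` increments at level `t`, each of size at
most `B / 2 ^ t`.

Factorization: one factor holds the level indicators, the other the increments, with weights
`(4/5)^t` and `(5/4)^t`. Squared column norms are then geometric sums of ratios `16/25` and `25/32`,
so `γ₂` is `O(B)`.

Protocol: each user applies randomized response to all indicators of levels up to `T`, with budget
proportional to `ε (4/5)^t` at level `t`. Two inputs differ in at most two bits per level, so the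
total budget is `ε`. Chaining in both arguments makes the truncated kernel biaffine in the bits, so
unbiased bit estimates can be substituted. The error is a linear plus a bilinear form in independent
centred noise, and distinct monomials are orthogonal (`integral_sq_sum_prod_bitNoise`). The linear
part contributes `O(B² / (ε² n))` uniformly in `T`. The bilinear part grows like `(25/16)^(2T)`,
slower than `4 ^ T`, while the squared bias of truncation is `O(B² / 4 ^ T)`; `4 ^ T ≈ ε² n`
balances them. The resulting bound has no logarithm, and `log k` enters only through `log k ≥ 1/2`
for `k ≥ 2`. -/

namespace PairwiseLDP

/-! ### Dyadic nets -/

/-- A nested sequence of maps `[k] → [k]`, the `t`-th of which takes at most `2 ^ t` values and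
moves no point by more than `k / 2 ^ t`. -/
structure DyadicNet (k : ℕ) where
  /-- The representative of a point at level `t`. -/
  rep : ℕ → Fin k → Fin k
  rep_zero : ∀ x y, rep 0 x = rep 0 y
  rep_rep_succ : ∀ t x, rep t (rep (t + 1) x) = rep t x
  abs_sub_rep_le : ∀ (t : ℕ) (x : Fin k), |((x : ℕ) : ℝ) - ((rep t x : ℕ) : ℝ)| ≤ k / 2 ^ t
  card_image_rep_le : ∀ t, (Finset.univ.image (rep t)).card ≤ 2 ^ t

theorem nonempty_dyadicNet {k : ℕ} (hk : 1 ≤ k) : Nonempty (DyadicNet k) := by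
  have : Nonempty (Fin k) := ⟨⟨0, hk⟩⟩
  -- Level `t` cuts `[k]` into `2 ^ t` intervals, each halved at the next level; `Function.invFun`
  -- picks one point in each nonempty cell.
  let cell : ℕ → Fin k → ℕ := fun t i => (i : ℕ) * 2 ^ t / k
  have cell_lt : ∀ t i, cell t i < 2 ^ t := fun t i =>
    Nat.div_lt_of_lt_mul (Nat.mul_lt_mul_of_pos_right i.2 (by positivity))
  have cell_succ : ∀ t i, cell t i = cell (t + 1) i / 2 := by
    intro t i
    simp only [cell]
    rw [Nat.div_div_eq_div_mul, pow_succ, ← mul_assoc, Nat.mul_div_mul_right _ _ (by norm_num)]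
  have cell_inv : ∀ t i, cell t (Function.invFun (cell t) (cell t i)) = cell t i := fun t i =>
    Function.invFun_eq ⟨i, rfl⟩
  have key : ∀ t i j, cell t i = cell t j → ((i : ℕ) : ℝ) - ((j : ℕ) : ℝ) ≤ k / 2 ^ t := by
    intro t i j h
    rw [le_div_iff₀ (by positivity)]
    have h1 : (i : ℕ) * 2 ^ t < cell t i * k + k := by
      have := Nat.lt_div_mul_add (a := (i : ℕ) * 2 ^ t) (b := k) hk
      simpa [cell] using this
    have h2 : cell t j * k ≤ (j : ℕ) * 2 ^ t := Nat.div_mul_le_self _ _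
    rw [h] at h1
    have h3 : (i : ℕ) * 2 ^ t ≤ (j : ℕ) * 2 ^ t + k := by omega
    have h4 : ((i : ℕ) : ℝ) * 2 ^ t ≤ ((j : ℕ) : ℝ) * 2 ^ t + k := by exact_mod_cast h3
    linarith
  refine ⟨⟨fun t i => Function.invFun (cell t) (cell t i), ?_, ?_, ?_, ?_⟩⟩
  · intro x y
    have hx := cell_lt 0 x
    have hy := cell_lt 0 y
    have : cell 0 x = cell 0 y := by simp at hx hy; omega
    simp only [this]
  · intro t x
    have : cell t (Function.invFun (cell (t + 1)) (cell (t + 1) x)) = cell t x := by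
      rw [cell_succ, cell_inv, ← cell_succ]
    simp only [this]
  · intro t x
    rw [abs_le]
    have h1 := key t x _ (cell_inv t x).symm
    have h2 := key t _ x (cell_inv t x)
    constructor <;> linarith
  · intro t
    calc _ ≤ ((Finset.range (2 ^ t)).image (Function.invFun (cell t))).card := by
          apply Finset.card_le_card
          intro p hp
          obtain ⟨x, -, rfl⟩ := Finset.mem_image.1 hp
          exact Finset.mem_image_of_mem _ (Finset.mem_range.2 (cell_lt t x))
      _ ≤ _ := Finset.card_image_le.trans (by simp)

/-! ### Increments between levels and their sizes -/

namespace DyadicNet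

variable {k : ℕ} (N : DyadicNet k)

/-- The change of `g` at the point `p` of level `t + 1` from its representative of level `t`. -/
noncomputable def detail (g : Fin k → ℝ) (t : ℕ) (p : Fin k) : ℝ :=
  if p ∈ Finset.univ.image (N.rep (t + 1)) then g p - g (N.rep t p) else 0

theorem detail_rep (g : Fin k → ℝ) (t : ℕ) (x : Fin k) :
    N.detail g t (N.rep (t + 1) x) = g (N.rep (t + 1) x) - g (N.rep t x) := by
  rw [detail, if_pos (Finset.mem_image_of_mem _ (Finset.mem_univ x)), N.rep_rep_succ]

/-- Telescoping over the levels: at each level only the indicator of the representative of `x`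
survives, and nestedness makes its coefficient the increment along the path of `x`. -/
theorem apply_rep_eq (g : Fin k → ℝ) (T : ℕ) (x : Fin k) :
    g (N.rep T x) = g (N.rep 0 x) +
      ∑ i : Fin T × Fin k, N.detail g i.1 i.2 * (if N.rep (i.1 + 1) x = i.2 then 1 else 0) := by
  rw [Fintype.sum_prod_type]
  simp only [mul_ite, mul_one, mul_zero, Finset.sum_ite_eq, Finset.mem_univ, if_true, detail_rep]
  rw [Fin.sum_univ_eq_sum_range (fun t => g (N.rep (t + 1) x) - g (N.rep t x)),
    Finset.sum_range_sub (fun t => g (N.rep t x))]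
  ring

theorem detail_add (g h : Fin k → ℝ) (t : ℕ) (p : Fin k) :
    N.detail (fun u => g u + h u) t p = N.detail g t p + N.detail h t p := by
  unfold detail
  split_ifs <;> ring

theorem detail_mul_const (g : Fin k → ℝ) (a : ℝ) (t : ℕ) (p : Fin k) :
    N.detail (fun u => g u * a) t p = N.detail g t p * a := by
  unfold detail
  split_ifs <;> ring

theorem detail_sum {ι : Type*} (s : Finset ι) (g : ι → Fin k → ℝ) (t : ℕ) (p : Fin k) :
    N.detail (fun u => ∑ i ∈ s, g i u) t p = ∑ i ∈ s, N.detail (g i) t p := by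
  unfold detail
  split_ifs
  · rw [Finset.sum_sub_distrib]
  · simp

theorem detail_comm (f : Fin k → Fin k → ℝ) (t t' : ℕ) (p p' : Fin k) :
    N.detail (fun u => N.detail (f u) t' p') t p =
      N.detail (fun w => N.detail (fun u => f u w) t p) t' p' := by
  unfold detail
  split_ifs <;> ring

/-- An upper bound for the detail coefficients of functions with Lipschitz constant `B / k`. -/
noncomputable def detailBound (B : ℝ) (t : ℕ) (p : Fin k) : ℝ :=
  if p ∈ Finset.univ.image (N.rep (t + 1)) then B / 2 ^ t else 0

theorem detailBound_nonneg {B : ℝ} (hB : 0 ≤ B) (t : ℕ) (p : Fin k) :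
    0 ≤ N.detailBound B t p := by
  unfold detailBound
  split_ifs <;> positivity

theorem abs_detail_le {g : Fin k → ℝ} {G : ℝ} (hG : 0 ≤ G)
    (hg : ∀ x y, |g x - g y| ≤ G * |((x : ℕ) : ℝ) - ((y : ℕ) : ℝ)|) (t : ℕ) (p : Fin k) :
    |N.detail g t p| ≤ N.detailBound (G * k) t p := by
  unfold detail detailBound
  split_ifs
  · calc _ ≤ G * |((p : ℕ) : ℝ) - ((N.rep t p : ℕ) : ℝ)| := hg _ _
      _ ≤ G * (k / 2 ^ t) := mul_le_mul_of_nonneg_left (N.abs_sub_rep_le t p) hG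
      _ = _ := by ring
  · simp

theorem abs_detail_detail_le {f : Fin k → Fin k → ℝ} {G : ℝ} (hG : 0 ≤ G)
    (hf : IsLipschitzKernel G f) (t t' : ℕ) (p p' : Fin k) :
    |N.detail (fun u => N.detail (f u) t' p') t p| ≤ 2 * N.detailBound (G * k) t' p' := by
  have h : ∀ u, |N.detail (f u) t' p'| ≤ N.detailBound (G * k) t' p' := fun u =>
    N.abs_detail_le hG (hf.1 u) t' p'
  have h0 : 0 ≤ N.detailBound (G * k) t' p' := N.detailBound_nonneg (by positivity) t' p'
  rw [detail]
  split_ifs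
  · refine (abs_sub _ _).trans ?_
    linarith [h p, h (N.rep t p)]
  · simp [h0]

/-- The mixed difference is a difference of two increments in either variable, hence at most twice
either bound. Multiplying the two estimates gives a product form, which later lets a double sum
factor into a square. -/
theorem sq_detail_detail_le {f : Fin k → Fin k → ℝ} {G : ℝ} (hG : 0 ≤ G)
    (hf : IsLipschitzKernel G f) (t t' : ℕ) (p p' : Fin k) :
    N.detail (fun u => N.detail (f u) t' p') t p ^ 2 ≤
      4 * (N.detailBound (G * k) t p * N.detailBound (G * k) t' p') := by
  have h1 := N.abs_detail_detail_le hG hf t t' p p'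
  have h2 := N.abs_detail_detail_le (f := fun u w => f w u) hG
    ⟨fun i j j' => hf.2 j j' i, fun i i' j => hf.1 j i i'⟩ t' t p' p
  rw [← N.detail_comm (f := f) t t' p p'] at h2
  rw [← sq_abs, sq]
  calc _ ≤ (2 * N.detailBound (G * k) t p) * (2 * N.detailBound (G * k) t' p') :=
        mul_le_mul h2 h1 (abs_nonneg _) ((abs_nonneg _).trans h2)
    _ = _ := by ring

theorem sum_detailBound_pow_le {B : ℝ} (hB : 0 ≤ B) (t : ℕ) {m : ℕ} (hm : m ≠ 0) :
    ∑ p, N.detailBound B t p ^ m ≤ 2 ^ (t + 1) * (B / 2 ^ t) ^ m := by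
  have : ∀ p, N.detailBound B t p ^ m =
      if p ∈ Finset.univ.image (N.rep (t + 1)) then (B / 2 ^ t) ^ m else 0 := by
    intro p
    unfold detailBound
    split_ifs <;> simp [hm]
  simp only [this, Finset.sum_ite_mem, Finset.univ_inter, Finset.sum_const, nsmul_eq_mul]
  gcongr
  exact_mod_cast N.card_image_rep_le (t + 1)

end DyadicNet
end PairwiseLDP

/-! ### The factorization norm of a Lipschitz kernel -/

namespace PairwiseLDP

theorem IsLipschitzKernel.sub_const {k : ℕ} {G : ℝ} {f : Fin k → Fin k → ℝ}
    (hf : IsLipschitzKernel G f) (c : ℝ) : IsLipschitzKernel G fun i j => f i j - c :=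
  ⟨fun i j j' => by simpa using hf.1 i j j', fun i i' j => by simpa using hf.2 i i' j⟩

theorem oneTwoNorm_nonneg {d k : ℕ} (A : Matrix (Fin d) (Fin k) ℝ) : 0 ≤ oneTwoNorm A :=
  Real.iSup_nonneg fun _ => Real.sqrt_nonneg _

theorem gammaTwo_le {k : ℕ} [Nonempty (Fin k)] {ι : Type*} [Fintype ι]
    (W : Matrix (Fin k) (Fin k) ℝ) (L R : ι → Fin k → ℝ) (hW : ∀ i j, W i j = ∑ s, L s i * R s j)
    {a b : ℝ} (ha : 0 ≤ a) (hb : 0 ≤ b) (hL : ∀ i, ∑ s, L s i ^ 2 ≤ a ^ 2)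
    (hR : ∀ j, ∑ s, R s j ^ 2 ≤ b ^ 2) : gammaTwo W ≤ a * b := by
  let e := (Fintype.equivFin ι).symm
  have hmem : oneTwoNorm (Matrix.of fun s i => L (e s) i) *
      oneTwoNorm (Matrix.of fun s j => R (e s) j) ∈
      {r : ℝ | ∃ (d : ℕ) (L R : Matrix (Fin d) (Fin k) ℝ),
        L.transpose * R = W ∧ r = oneTwoNorm L * oneTwoNorm R} := by
    refine ⟨_, _, _, ?_, rfl⟩
    ext i j
    simp only [Matrix.mul_apply, Matrix.transpose_apply, Matrix.of_apply]
    rw [hW, e.sum_comp fun s => L s i * R s j]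
  refine (csInf_le ⟨0, ?_⟩ hmem).trans ?_
  · rintro r ⟨d, L, R, -, rfl⟩
    exact mul_nonneg (oneTwoNorm_nonneg L) (oneTwoNorm_nonneg R)
  · refine mul_le_mul ?_ ?_ (oneTwoNorm_nonneg _) ha
    · refine ciSup_le fun i => Real.sqrt_le_iff.2 ⟨ha, ?_⟩
      simp only [Matrix.of_apply]
      rw [e.sum_comp fun s => L s i ^ 2]
      exact hL i
    · refine ciSup_le fun j => Real.sqrt_le_iff.2 ⟨hb, ?_⟩
      simp only [Matrix.of_apply]
      rw [e.sum_comp fun s => R s j ^ 2]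
      exact hR j

theorem sum_range_geometric_le {r : ℝ} (h0 : 0 ≤ r) (h1 : r < 1) (T : ℕ) :
    ∑ t ∈ Finset.range T, r ^ t ≤ 1 / (1 - r) := by
  rw [geom_sum_eq h1.ne, ← neg_div_neg_eq]
  have : 0 ≤ r ^ T := pow_nonneg h0 T
  have : 0 < 1 - r := by linarith
  rw [neg_sub, neg_sub]
  gcongr
  linarith

theorem gammaTwo_kernelMatrix_le {k : ℕ} (hk : 1 ≤ k) {G : ℝ} (hG : 0 ≤ G)
    {f : Fin k → Fin k → ℝ} (hf : IsLipschitzKernel G f) (hb : ∀ i j, |f i j| ≤ G * k) :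
    gammaTwo (kernelMatrix f) ≤ 16 * (G * k) := by
  have : Nonempty (Fin k) := ⟨⟨0, hk⟩⟩
  obtain ⟨N⟩ := nonempty_dyadicNet hk
  have hB : 0 ≤ G * k := by positivity
  -- At level `k` the net is exact, since integers at distance at most `k / 2 ^ k < 1` coincide.
  have hid : ∀ x, N.rep k x = x := by
    intro x
    have h1 := N.abs_sub_rep_le k x
    have h2 : (k : ℝ) / 2 ^ k < 1 := by
      rw [div_lt_one (by positivity)]
      exact_mod_cast Nat.lt_two_pow_self
    have h3 : |((x : ℕ) : ℤ) - ((N.rep k x : ℕ) : ℤ)| < 1 := by exact_mod_cast h1.trans_lt h2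
    have h4 := Int.abs_lt_one_iff.1 h3
    exact Fin.ext (by omega)
  let x₀ : Fin k := ⟨0, hk⟩
  -- `none` carries the level-zero term. Any weight `r ^ t` with `1/2 < r ^ 2 < 1` would keep both
  -- column sums bounded.
  let L : Option (Fin k × Fin k) → Fin k → ℝ := fun s i =>
    s.elim 1 fun s => (4 / 5) ^ (s.1 : ℕ) * if N.rep (s.1 + 1) i = s.2 then 1 else 0
  let R : Option (Fin k × Fin k) → Fin k → ℝ := fun s j =>
    s.elim (f (N.rep 0 x₀) j) fun s => (5 / 4) ^ (s.1 : ℕ) * N.detail (fun u => f u j) s.1 s.2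
  have hsum : ∀ T, ∑ t ∈ Finset.range T, ((16 : ℝ) / 25) ^ t ≤ 3 := fun T =>
    (sum_range_geometric_le (by norm_num) (by norm_num) T).trans (by norm_num)
  have hsum' : ∀ T, ∑ t ∈ Finset.range T, ((25 : ℝ) / 32) ^ t ≤ 5 := fun T =>
    (sum_range_geometric_le (by norm_num) (by norm_num) T).trans (by norm_num)
  refine (gammaTwo_le (a := 4) (b := 4 * (G * k)) _ L R ?_ (by norm_num) (by positivity)
    ?_ ?_).trans (by linarith)
  · intro i j
    have h := N.apply_rep_eq (fun u => f u j) k i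
    rw [hid] at h
    rw [kernelMatrix, Matrix.of_apply, h, Fintype.sum_option, N.rep_zero i x₀]
    simp only [L, R, Option.elim, one_mul]
    congr 1
    refine Finset.sum_congr rfl fun s _ => ?_
    have : ((4 : ℝ) / 5) ^ (s.1 : ℕ) * (5 / 4) ^ (s.1 : ℕ) = 1 := by
      rw [← mul_pow]; norm_num
    linear_combination (-(N.detail (fun u => f u j) s.1 s.2 *
      (if N.rep (s.1 + 1) i = s.2 then 1 else 0))) * this
  · intro i
    rw [Fintype.sum_option, Fintype.sum_prod_type]
    simp only [L, Option.elim]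
    have h1 : ∀ t : Fin k, ∑ p, ((4 / 5) ^ (t : ℕ) *
        if N.rep (t + 1) i = p then (1 : ℝ) else 0) ^ 2 = (16 / 25) ^ (t : ℕ) := by
      intro t
      simp only [ite_pow, ne_eq, OfNat.ofNat_ne_zero, not_false_eq_true, zero_pow,
        mul_ite, mul_one, mul_zero, Finset.sum_ite_eq, Finset.mem_univ, if_true]
      rw [← pow_mul, mul_comm _ 2, pow_mul]
      norm_num
    simp only [h1]
    rw [Fin.sum_univ_eq_sum_range (fun t => ((16 : ℝ) / 25) ^ t)]
    linarith [hsum k]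
  · intro j
    rw [Fintype.sum_option, Fintype.sum_prod_type]
    simp only [R, Option.elim]
    have h1 : f (N.rep 0 x₀) j ^ 2 ≤ (G * k) ^ 2 :=
      sq_le_sq' (abs_le.1 (hb _ _)).1 (abs_le.1 (hb _ _)).2
    have h2 : ∀ t : Fin k, ∑ p, ((5 / 4) ^ (t : ℕ) * N.detail (fun u => f u j) t p) ^ 2 ≤
        2 * (G * k) ^ 2 * (25 / 32) ^ (t : ℕ) := by
      intro t
      calc _ ≤ ∑ p, (25 / 16) ^ (t : ℕ) * N.detailBound (G * k) t p ^ 2 := by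
            refine Finset.sum_le_sum fun p _ => ?_
            rw [mul_pow, ← pow_mul, mul_comm _ 2, pow_mul, show ((5 : ℝ) / 4) ^ 2 = 25 / 16 by norm_num,
              ← sq_abs (N.detail _ _ _)]
            gcongr
            exact N.abs_detail_le hG (fun x y => hf.2 x y j) t p
        _ ≤ (25 / 16) ^ (t : ℕ) * (2 ^ ((t : ℕ) + 1) * (G * k / 2 ^ (t : ℕ)) ^ 2) := by
            rw [← Finset.mul_sum]
            gcongr
            exact N.sum_detailBound_pow_le hB t two_ne_zero
        _ = _ := by
            rw [show (25 / 32 : ℝ) = 25 / 16 / 2 by norm_num, div_pow (25 / 16 : ℝ) 2]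
            field_simp
            ring
    calc _ ≤ (G * k) ^ 2 + ∑ t : Fin k, 2 * (G * k) ^ 2 * (25 / 32) ^ (t : ℕ) :=
          add_le_add h1 (Finset.sum_le_sum fun t _ => h2 t)
      _ = (G * k) ^ 2 + 2 * (G * k) ^ 2 * ∑ t ∈ Finset.range k, (25 / 32) ^ t := by
          rw [← Finset.mul_sum, Fin.sum_univ_eq_sum_range (fun t => ((25 : ℝ) / 32) ^ t)]
      _ ≤ (G * k) ^ 2 + 2 * (G * k) ^ 2 * 5 := by
          gcongr
          exact hsum' k
      _ ≤ _ := by nlinarith [sq_nonneg (G * k)]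

/-- Every point is within `k / 2` of the centre in each coordinate, so the central value serves as
the normalizing constant. -/
theorem IsLipschitzKernel.abs_sub_apply_middle_le {k : ℕ} (hk : 1 ≤ k) {G : ℝ} (hG : 0 ≤ G)
    {f : Fin k → Fin k → ℝ} (hf : IsLipschitzKernel G f) (i j : Fin k) :
    |f i j - f ⟨k / 2, by omega⟩ ⟨k / 2, by omega⟩| ≤ G * k := by
  have h : ∀ i : Fin k, |((i : ℕ) : ℝ) - ((k / 2 : ℕ) : ℝ)| ≤ k / 2 := by
    intro i
    have h1 : 2 * (i : ℕ) ≤ 2 * (k / 2) + k := by omega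
    have h2 : 2 * (k / 2) ≤ 2 * (i : ℕ) + k := by omega
    have h3 : 2 * ((i : ℕ) : ℝ) ≤ 2 * ((k / 2 : ℕ) : ℝ) + k := by exact_mod_cast h1
    have h4 : 2 * ((k / 2 : ℕ) : ℝ) ≤ 2 * ((i : ℕ) : ℝ) + k := by exact_mod_cast h2
    rw [abs_le]
    constructor <;> linarith
  have h1 := (hf.1 i j ⟨k / 2, by omega⟩).trans (mul_le_mul_of_nonneg_left (h j) hG)
  have h2 := (hf.2 i ⟨k / 2, by omega⟩ ⟨k / 2, by omega⟩).trans
    (mul_le_mul_of_nonneg_left (h i) hG)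
  refine (abs_sub_le _ _ _).trans ((add_le_add h1 h2).trans ?_)
  linarith

end PairwiseLDP

namespace PairwiseLDP

/-! ### Randomized response on one bit -/

/-- The real number `0` or `1` of a bit. -/
def bitVal (b : Bool) : ℝ := if b then 1 else 0

/-- The law of the response to the bit `b` with privacy parameter `e`. -/
noncomputable def bitLaw (e : ℝ) (b : Bool) : Measure Bool :=
  ENNReal.ofReal (Real.exp e / (1 + Real.exp e)) • Measure.dirac b +
    ENNReal.ofReal (1 / (1 + Real.exp e)) • Measure.dirac (!b)

/-- The unbiased estimate of a bit from its randomized response. -/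
noncomputable def bitEstimate (e : ℝ) (m : Bool) : ℝ :=
  if m then Real.exp e / (Real.exp e - 1) else -1 / (Real.exp e - 1)

/-- The variance of the unbiased estimate of a bit. -/
noncomputable def bitVariance (e : ℝ) : ℝ := Real.exp e / (Real.exp e - 1) ^ 2

instance (e : ℝ) (b : Bool) : IsProbabilityMeasure (bitLaw e b) := by
  constructor
  simp only [bitLaw, Measure.coe_add, Measure.coe_smul, Pi.add_apply, Pi.smul_apply, measure_univ,
    smul_eq_mul, mul_one]
  have := Real.exp_pos e
  rw [← ENNReal.ofReal_add (by positivity) (by positivity), ← add_div, add_comm, div_self (by positivity),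
    ENNReal.ofReal_one]

theorem integral_bitLaw (e : ℝ) (b : Bool) (g : Bool → ℝ) :
    ∫ m, g m ∂bitLaw e b =
      Real.exp e / (1 + Real.exp e) * g b + 1 / (1 + Real.exp e) * g (!b) := by
  have := Real.exp_pos e
  have hi : ∀ (b : Bool) (c : ENNReal), c ≠ ⊤ → Integrable g (c • Measure.dirac b) := fun b c hc =>
    (Integrable.of_finite (f := g) (μ := Measure.dirac b)).smul_measure hc
  rw [bitLaw, integral_add_measure (hi _ _ ENNReal.ofReal_ne_top) (hi _ _ ENNReal.ofReal_ne_top),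
    integral_smul_measure, integral_smul_measure, integral_dirac, integral_dirac,
    ENNReal.toReal_ofReal (by positivity), ENNReal.toReal_ofReal (by positivity)]
  rfl

theorem integral_bitEstimate_sub {e : ℝ} (he : 0 < e) (b : Bool) :
    ∫ m, (bitEstimate e m - bitVal b) ∂bitLaw e b = 0 := by
  have h1 : 0 < Real.exp e - 1 := by linarith [Real.add_one_lt_exp he.ne']
  have h2 : 0 < 1 + Real.exp e := by linarith
  rw [integral_bitLaw]
  cases b <;> simp [bitEstimate, bitVal] <;> field_simp <;> ring

theorem integral_sq_bitEstimate_sub {e : ℝ} (he : 0 < e) (b : Bool) :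
    ∫ m, (bitEstimate e m - bitVal b) ^ 2 ∂bitLaw e b = bitVariance e := by
  have h1 : 0 < Real.exp e - 1 := by linarith [Real.add_one_lt_exp he.ne']
  have h2 : 0 < 1 + Real.exp e := by linarith
  rw [integral_bitLaw, bitVariance]
  cases b <;> simp [bitEstimate, bitVal] <;> field_simp <;> ring

theorem bitVariance_nonneg (e : ℝ) : 0 ≤ bitVariance e := by
  have := Real.exp_pos e
  unfold bitVariance
  positivity

/-- The variance equals `1 / (4 sinh² (e / 2))`, and `sinh s ≥ s` for `s ≥ 0`. -/
theorem bitVariance_le {e : ℝ} (he : 0 < e) : bitVariance e ≤ 1 / e ^ 2 := by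
  have h1 : 0 < Real.exp e - 1 := by linarith [Real.add_one_lt_exp he.ne']
  have hs := Real.self_le_sinh_iff.2 (half_pos he).le
  rw [Real.sinh_eq, Real.exp_neg] at hs
  have hp := Real.exp_pos (e / 2)
  have hsq : Real.exp e = Real.exp (e / 2) ^ 2 := by
    rw [← Real.exp_nat_mul]
    congr 1
    push_cast
    ring
  have hle : e * Real.exp (e / 2) ≤ Real.exp e - 1 := by
    have := mul_le_mul_of_nonneg_right hs hp.le
    have h3 : (Real.exp (e / 2))⁻¹ * Real.exp (e / 2) = 1 := inv_mul_cancel₀ hp.ne'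
    nlinarith
  rw [bitVariance, div_le_div_iff₀ (by positivity) (by positivity)]
  calc Real.exp e * e ^ 2 = (e * Real.exp (e / 2)) ^ 2 := by rw [hsq]; ring
    _ ≤ (Real.exp e - 1) ^ 2 := by gcongr
    _ = _ := by ring

theorem bitLaw_singleton_le {e : ℝ} (he : 0 ≤ e) (b b' m : Bool) :
    bitLaw e b {m} ≤ ENNReal.ofReal (Real.exp (if b = b' then 0 else e)) * bitLaw e b' {m} := by
  have h0 := Real.exp_pos e
  have h1 := Real.one_le_exp he
  have h2 : 0 < 1 + Real.exp e := by positivity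
  by_cases hb : b = b'
  · simp [hb]
  · have key : ∀ b m : Bool, bitLaw e b {m} = ENNReal.ofReal
        (if m = b then Real.exp e / (1 + Real.exp e) else 1 / (1 + Real.exp e)) := by
      intro b m
      cases b <;> cases m <;> simp [bitLaw]
    rw [if_neg hb, key, key, ← ENNReal.ofReal_mul h0.le]
    apply ENNReal.ofReal_le_ofReal
    have h3 : 1 / (1 + Real.exp e) ≤ Real.exp e * (Real.exp e / (1 + Real.exp e)) := by
      rw [← mul_div_assoc]
      gcongr
      nlinarith
    have h4 : Real.exp e / (1 + Real.exp e) = Real.exp e * (1 / (1 + Real.exp e)) := by ring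
    cases b <;> cases b' <;> cases m <;>
      first | exact absurd rfl hb | simpa using h3 | simp [div_eq_mul_inv]

/-! ### Randomized response on a family of bits -/

/-- Likelihood ratios multiply over independent bits, and coordinates where the inputs agree cost
nothing. -/
theorem pi_bitLaw_le {ι : Type} [Fintype ι] {e : ι → ℝ} (he : ∀ i, 0 ≤ e i) (b b' : ι → Bool)
    {ε : ℝ} (hε : ∑ i, (if b i = b' i then 0 else e i) ≤ ε) (S : Set (ι → Bool)) :
    Measure.pi (fun i => bitLaw (e i) (b i)) S ≤
      ENNReal.ofReal (Real.exp ε) * Measure.pi (fun i => bitLaw (e i) (b' i)) S := by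
  classical
  have hS : S = ((Set.toFinite S).toFinset : Set (ι → Bool)) := by simp
  rw [hS, ← sum_measure_singleton, ← sum_measure_singleton, Finset.mul_sum]
  refine Finset.sum_le_sum fun m _ => ?_
  rw [Measure.pi_singleton, Measure.pi_singleton]
  calc _ ≤ ∏ i, (ENNReal.ofReal (Real.exp (if b i = b' i then 0 else e i)) *
          bitLaw (e i) (b' i) {m i}) :=
        Finset.prod_le_prod' fun i _ => bitLaw_singleton_le (he i) _ _ _
    _ ≤ _ := by
        rw [Finset.prod_mul_distrib, ← ENNReal.ofReal_prod_of_nonneg fun i _ => (Real.exp_pos _).le,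
          ← Real.exp_sum]
        gcongr

/-- The centred estimates of the bits `b a i` of users `a`, as functions of the messages. -/
noncomputable def bitNoise {n : ℕ} {ι : Type} (e : ι → ℝ) (b : Fin n → ι → Bool) (j : Fin n × ι)
    (y : Fin n → ι → Bool) : ℝ :=
  bitEstimate (e j.2) (y j.1 j.2) - bitVal (b j.1 j.2)

/-- By independence the integral factors over coordinates; one lying in exactly one of the two sets
contributes a mean, which is zero. -/
theorem integral_prod_bitNoise_mul {n : ℕ} {ι : Type} [Fintype ι] [DecidableEq ι] {e : ι → ℝ}
    (he : ∀ i, 0 < e i) (b : Fin n → ι → Bool) (s s' : Finset (Fin n × ι)) :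
    ∫ y, (∏ j ∈ s, bitNoise e b j y) * (∏ j ∈ s', bitNoise e b j y)
        ∂(Measure.pi fun a => Measure.pi fun i => bitLaw (e i) (b a i)) =
      if s = s' then ∏ j ∈ s, bitVariance (e j.2) else 0 := by
  let g : Fin n × ι → Bool → ℝ := fun j m =>
    (if j ∈ s then bitEstimate (e j.2) m - bitVal (b j.1 j.2) else 1) *
      (if j ∈ s' then bitEstimate (e j.2) m - bitVal (b j.1 j.2) else 1)
  have hg : ∀ j, ∫ m, g j m ∂bitLaw (e j.2) (b j.1 j.2) =
      if (j ∈ s ↔ j ∈ s') then (if j ∈ s then bitVariance (e j.2) else 1) else 0 := by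
    intro j
    by_cases h : j ∈ s <;> by_cases h' : j ∈ s' <;> simp only [g, h, h', if_true, if_false, one_mul,
      mul_one, iff_true, iff_false, iff_self, not_true]
    · simp only [← sq]
      exact integral_sq_bitEstimate_sub (he _) _
    · exact integral_bitEstimate_sub (he _) _
    · exact integral_bitEstimate_sub (he _) _
    · rw [integral_const, probReal_univ, one_smul]
  have hint : ∫ y, (∏ j ∈ s, bitNoise e b j y) * (∏ j ∈ s', bitNoise e b j y)
        ∂(Measure.pi fun a => Measure.pi fun i => bitLaw (e i) (b a i)) =
      ∏ j : Fin n × ι, ∫ m, g j m ∂bitLaw (e j.2) (b j.1 j.2) := by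
    rw [Fintype.prod_prod_type]
    simp_rw [← integral_fintype_prod_eq_prod]
    congr 1
    ext y
    rw [← Fintype.prod_prod_type' (f := fun a i => g (a, i) (y a i))]
    simp only [g, Finset.prod_mul_distrib, Finset.prod_ite_mem, Finset.univ_inter, bitNoise]
  rw [hint]
  simp only [hg]
  split_ifs with h
  · subst h
    simp [Finset.prod_ite_mem]
  · obtain ⟨j, hj⟩ : ∃ j, ¬ (j ∈ s ↔ j ∈ s') := by
      by_contra hcon
      push Not at hcon
      exact h (Finset.ext hcon)
    exact Finset.prod_eq_zero (Finset.mem_univ j) (if_neg hj)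

/-- Distinct monomials in the noise are orthogonal. -/
theorem integral_sq_sum_prod_bitNoise {n : ℕ} {ι P : Type} [Fintype ι] {e : ι → ℝ}
    (he : ∀ i, 0 < e i) (b : Fin n → ι → Bool) (s : Finset P) (m : P → Finset (Fin n × ι))
    (hm : Set.InjOn m s) (c : P → ℝ) :
    ∫ y, (∑ p ∈ s, c p * ∏ j ∈ m p, bitNoise e b j y) ^ 2
        ∂(Measure.pi fun a => Measure.pi fun i => bitLaw (e i) (b a i)) =
      ∑ p ∈ s, c p ^ 2 * ∏ j ∈ m p, bitVariance (e j.2) := by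
  classical
  simp_rw [sq (∑ p ∈ s, _), Finset.sum_mul_sum]
  rw [integral_finsetSum _ fun _ _ => Integrable.of_finite]
  refine Finset.sum_congr rfl fun p hp => ?_
  rw [integral_finsetSum _ fun _ _ => Integrable.of_finite]
  simp_rw [mul_mul_mul_comm, integral_const_mul, integral_prod_bitNoise_mul he]
  rw [Finset.sum_eq_single p]
  · rw [if_pos rfl, sq]
  · intro q hq hqp
    rw [if_neg fun h => hqp (hm hq hp h.symm), mul_zero]
  · exact fun h => absurd hp h

end PairwiseLDP

namespace PairwiseLDP

/-! ### Pairwise statistics of biaffine functions of bits -/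

/-- The coefficients of a biaffine function on `ℝ^ι × ℝ^ι`. -/
structure Biaffine (ι : Type) where
  /-- The constant coefficient. -/
  const : ℝ
  /-- The linear coefficients in the first argument. -/
  left : ι → ℝ
  /-- The linear coefficients in the second argument. -/
  right : ι → ℝ
  /-- The bilinear coefficients. -/
  mixed : ι → ι → ℝ

namespace Biaffine

variable {ι : Type} [Fintype ι] (B : Biaffine ι)

/-- The value of a biaffine function. -/
noncomputable def eval (u v : ι → ℝ) : ℝ :=
  B.const + ∑ i, B.left i * u i + ∑ l, B.right l * v l + ∑ i, ∑ l, B.mixed i l * (u i * v l)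

/-- The slope in the first argument, as a function of the second. -/
noncomputable def slopeLeft (v : ι → ℝ) (i : ι) : ℝ := B.left i + ∑ l, B.mixed i l * v l

/-- The slope in the second argument, as a function of the first. -/
noncomputable def slopeRight (u : ι → ℝ) (l : ι) : ℝ := B.right l + ∑ i, B.mixed i l * u i

/-- The exact Taylor expansion at `(u, v)`, used with true bits as base point and noise as
increment. -/
theorem eval_eq (u v u' v' : ι → ℝ) :
    B.eval u' v' = B.eval u v + ∑ i, B.slopeLeft v i * (u' i - u i) +
      ∑ l, B.slopeRight u l * (v' l - v l) +
        ∑ i, ∑ l, B.mixed i l * ((u' i - u i) * (v' l - v l)) := by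
  have h1 : ∑ i, B.slopeLeft v i * (u' i - u i) = ∑ i, B.left i * (u' i - u i) +
      ∑ i, ∑ l, B.mixed i l * ((u' i - u i) * v l) := by
    simp only [slopeLeft, add_mul, Finset.sum_add_distrib, Finset.sum_mul]
    congr 1
    exact Finset.sum_congr rfl fun i _ => Finset.sum_congr rfl fun l _ => by ring
  have h2 : ∑ l, B.slopeRight u l * (v' l - v l) = ∑ l, B.right l * (v' l - v l) +
      ∑ i, ∑ l, B.mixed i l * (u i * (v' l - v l)) := by
    rw [Finset.sum_comm (f := fun i l => B.mixed i l * (u i * (v' l - v l)))]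
    simp only [slopeRight, add_mul, Finset.sum_add_distrib, Finset.sum_mul]
    congr 1
    exact Finset.sum_congr rfl fun i _ => Finset.sum_congr rfl fun l _ => by ring
  rw [h1, h2]
  simp only [eval, sub_mul, mul_sub, Finset.sum_sub_distrib]
  ring

end Biaffine

/-! ### The bit protocol and its variance -/

variable {k n : ℕ} {ι : Type} [Fintype ι]

/-- The protocol in which every user applies randomized response to the bits `φ v` of its input
`v`, and the analyst estimates the pairwise statistic of a biaffine function of these bits. -/
noncomputable def bitProtocol (k n : ℕ) (φ : Fin k → ι → Bool) (e : ι → ℝ) (B : Biaffine ι) :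
    Protocol k n where
  Msg := ι → Bool
  randomizer v := Measure.pi fun i => bitLaw (e i) (φ v i)
  randomizer_prob _ := inferInstance
  estimate y := ((n.choose 2 : ℕ) : ℝ)⁻¹ *
    ∑ p ∈ Finset.univ.filter (fun p : Fin n × Fin n => p.1 < p.2),
      B.eval (fun i => bitEstimate (e i) (y p.1 i)) (fun i => bitEstimate (e i) (y p.2 i))
  estimate_measurable := measurable_of_finite _

theorem bitProtocol_isLocalDP {φ : Fin k → ι → Bool} {e : ι → ℝ} (he : ∀ i, 0 ≤ e i) {ε : ℝ}
    (hε : ∀ v v', ∑ i, (if φ v i = φ v' i then 0 else e i) ≤ ε) (B : Biaffine ι) :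
    (bitProtocol k n φ e B).IsLocalDP ε :=
  fun v v' S _ => pi_bitLaw_le he (φ v) (φ v') (hε v v') S

/-- The kernel whose pairwise statistic `bitProtocol` estimates without bias. -/
noncomputable def bitKernel (φ : Fin k → ι → Bool) (B : Biaffine ι) (u v : Fin k) : ℝ :=
  B.eval (fun i => bitVal (φ u i)) (fun i => bitVal (φ v i))

/-- The coefficients of the linear part of the error of `bitProtocol`. -/
noncomputable def linearCoeff (φ : Fin k → ι → Bool) (B : Biaffine ι) (x : Fin n → Fin k)
    (j : Fin n × ι) : ℝ :=
  ∑ a, ((if j.1 < a then B.slopeLeft (fun i => bitVal (φ (x a) i)) j.2 else 0) +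
    if a < j.1 then B.slopeRight (fun i => bitVal (φ (x a) i)) j.2 else 0)

theorem bitProtocol_estimate_eq (φ : Fin k → ι → Bool) (e : ι → ℝ) (B : Biaffine ι)
    (x : Fin n → Fin k) (y : Fin n → ι → Bool) :
    (bitProtocol k n φ e B).estimate y = pairwiseStatistic (bitKernel φ B) x +
      ((n.choose 2 : ℕ) : ℝ)⁻¹ *
        (∑ j, linearCoeff φ B x j * bitNoise e (fun a => φ (x a)) j y +
          ∑ p ∈ Finset.univ.filter (fun p : (Fin n × Fin n) × (ι × ι) => p.1.1 < p.1.2),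
            B.mixed p.2.1 p.2.2 * (bitNoise e (fun a => φ (x a)) (p.1.1, p.2.1) y *
              bitNoise e (fun a => φ (x a)) (p.1.2, p.2.2) y)) := by
  rw [pairwiseStatistic, ← mul_add]
  simp only [bitProtocol]
  congr 1
  have h : ∀ p : Fin n × Fin n, B.eval (fun i => bitEstimate (e i) (y p.1 i))
      (fun i => bitEstimate (e i) (y p.2 i)) = bitKernel φ B (x p.1) (x p.2) +
      (∑ i, B.slopeLeft (fun i => bitVal (φ (x p.2) i)) i *
          bitNoise e (fun a => φ (x a)) (p.1, i) y +
        ∑ i, B.slopeRight (fun i => bitVal (φ (x p.1) i)) i *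
          bitNoise e (fun a => φ (x a)) (p.2, i) y) +
      ∑ q : ι × ι, B.mixed q.1 q.2 * (bitNoise e (fun a => φ (x a)) (p.1, q.1) y *
              bitNoise e (fun a => φ (x a)) (p.2, q.2) y) := by
    intro p
    rw [B.eval_eq (fun i => bitVal (φ (x p.1) i)) (fun i => bitVal (φ (x p.2) i)),
      Fintype.sum_prod_type, bitKernel, ← add_assoc]
    rfl
  simp only [h]
  rw [Finset.sum_add_distrib, Finset.sum_add_distrib, add_assoc]
  congr 2
  · rw [Finset.sum_add_distrib]
    simp only [linearCoeff, Finset.sum_filter, Fintype.sum_prod_type, add_mul, Finset.sum_mul,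
      Finset.sum_add_distrib, ite_mul, zero_mul]
    congr 1
    · refine Finset.sum_congr rfl fun a _ => ?_
      rw [Finset.sum_comm]
      refine Finset.sum_congr rfl fun a' _ => ?_
      split_ifs <;> simp
    · rw [Finset.sum_comm]
      refine Finset.sum_congr rfl fun a _ => ?_
      rw [Finset.sum_comm]
      refine Finset.sum_congr rfl fun a' _ => ?_
      split_ifs <;> simp
  · rw [Finset.sum_filter, Finset.sum_filter, Fintype.sum_prod_type (α₂ := ι × ι)]
    refine Finset.sum_congr rfl fun p _ => ?_
    split_ifs <;> simp

theorem sq_linearCoeff_le {φ : Fin k → ι → Bool} {B : Biaffine ι} {M : ι → ℝ}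
    (hl : ∀ v i, |B.slopeLeft (fun i => bitVal (φ v i)) i| ≤ M i)
    (hr : ∀ v i, |B.slopeRight (fun i => bitVal (φ v i)) i| ≤ M i)
    (x : Fin n → Fin k) (j : Fin n × ι) :
    linearCoeff φ B x j ^ 2 ≤ (n : ℝ) ^ 2 * M j.2 ^ 2 := by
  rw [← mul_pow, ← sq_abs]
  have h : |linearCoeff φ B x j| ≤ n * M j.2 := by
    refine (Finset.abs_sum_le_sum_abs _ _).trans ?_
    refine (Finset.sum_le_sum (g := fun _ => M j.2) fun a _ => ?_).trans (by simp)
    have h0 := (abs_nonneg _).trans (hl (x a) j.2)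
    rcases lt_trichotomy j.1 a with h | h | h
    · simpa [h, h.not_gt] using hl (x a) j.2
    · simpa [h] using h0
    · simpa [h, h.not_gt] using hr (x a) j.2
  gcongr

theorem inv_choose_two_le (hn : 2 ≤ n) : ((n.choose 2 : ℕ) : ℝ)⁻¹ ≤ 4 / (n : ℝ) ^ 2 := by
  have h2 : (2 : ℝ) ≤ n := by exact_mod_cast hn
  rw [Nat.cast_choose_two, inv_div, div_le_div_iff₀ (by nlinarith) (by positivity)]
  nlinarith

/-- Orthogonality leaves sums of squared coefficients times variances. There are `n` users with
squared linear coefficients at most `n² M²`, and at most `n²` pairs for the bilinear part; the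
squared normalization `(4 / n²)²` yields orders `1 / n` and `1 / n²`. -/
theorem integral_sq_bitProtocol_sub_le (hn : 2 ≤ n) {φ : Fin k → ι → Bool} {e : ι → ℝ}
    (he : ∀ i, 0 < e i) {B : Biaffine ι} {M V : ι → ℝ} (hV : ∀ i, bitVariance (e i) ≤ V i)
    (hl : ∀ v i, |B.slopeLeft (fun i => bitVal (φ v i)) i| ≤ M i)
    (hr : ∀ v i, |B.slopeRight (fun i => bitVal (φ v i)) i| ≤ M i)
    (hm : ∀ i l, B.mixed i l ^ 2 ≤ 4 * (M i * M l)) (x : Fin n → Fin k) :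
    ∫ y, ((bitProtocol k n φ e B).estimate y - pairwiseStatistic (bitKernel φ B) x) ^ 2
        ∂(Measure.pi fun a => Measure.pi fun i => bitLaw (e i) (φ (x a) i)) ≤
      32 / n * ∑ i, M i ^ 2 * V i + 128 / (n : ℝ) ^ 2 * (∑ i, M i * V i) ^ 2 := by
  classical
  have hn0 : (0 : ℝ) < n := by exact_mod_cast (by omega : 0 < n)
  have hc := inv_choose_two_le hn
  set η := bitNoise e (fun a => φ (x a)) with hη
  set μ := Measure.pi fun a : Fin n => Measure.pi fun i => bitLaw (e i) (φ (x a) i) with hμ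
  set Q := Finset.univ.filter (fun p : (Fin n × Fin n) × (ι × ι) => p.1.1 < p.1.2) with hQ
  have hlin : ∫ y, (∑ j, linearCoeff φ B x j * η j y) ^ 2 ∂μ ≤
      (n : ℝ) ^ 3 * ∑ i, M i ^ 2 * V i := by
    have h := integral_sq_sum_prod_bitNoise he (fun a => φ (x a)) Finset.univ
      (fun j : Fin n × ι => {j}) (fun _ _ _ _ h => Finset.singleton_injective h)
      (linearCoeff φ B x)
    simp only [Finset.prod_singleton] at h
    rw [h]
    calc _ ≤ ∑ j : Fin n × ι, (n : ℝ) ^ 2 * (M j.2 ^ 2 * V j.2) := by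
          refine Finset.sum_le_sum fun j _ => ?_
          rw [← mul_assoc]
          exact mul_le_mul (sq_linearCoeff_le hl hr x j) (hV _) (bitVariance_nonneg _)
            (by positivity)
      _ = _ := by
          rw [Fintype.sum_prod_type]
          simp only [Finset.sum_const, Finset.card_univ, Fintype.card_fin, nsmul_eq_mul,
            Finset.mul_sum]
          refine Finset.sum_congr rfl fun i _ => by ring
  have hquad : ∫ y, (∑ p ∈ Q, B.mixed p.2.1 p.2.2 * (η (p.1.1, p.2.1) y * η (p.1.2, p.2.2) y)) ^ 2
      ∂μ ≤ 4 * (n : ℝ) ^ 2 * (∑ i, M i * V i) ^ 2 := by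
    have hne : ∀ p ∈ Q, (p.1.1, p.2.1) ≠ (p.1.2, p.2.2) := by
      intro p hp h
      exact (Finset.mem_filter.1 hp).2.ne (Prod.ext_iff.1 h).1
    -- The order `a < b` tells which element of the unordered pair belongs to which user.
    have hinj : Set.InjOn (fun p : (Fin n × Fin n) × (ι × ι) =>
        ({(p.1.1, p.2.1), (p.1.2, p.2.2)} : Finset (Fin n × ι))) Q := by
      rintro ⟨⟨a, b⟩, i, l⟩ hp ⟨⟨a', b'⟩, i', l'⟩ hp' h
      have hab : a < b := (Finset.mem_filter.1 hp).2
      have hab' : a' < b' := (Finset.mem_filter.1 hp').2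
      have h1 : (a, i) ∈ ({(a', i'), (b', l')} : Finset (Fin n × ι)) := by
        rw [← show ({(a, i), (b, l)} : Finset (Fin n × ι)) = {(a', i'), (b', l')} from h]; simp
      have h2 : (b, l) ∈ ({(a', i'), (b', l')} : Finset (Fin n × ι)) := by
        rw [← show ({(a, i), (b, l)} : Finset (Fin n × ι)) = {(a', i'), (b', l')} from h]; simp
      simp only [Finset.mem_insert, Finset.mem_singleton, Prod.mk.injEq] at h1 h2 ⊢
      rcases h1 with ⟨rfl, rfl⟩ | ⟨rfl, rfl⟩ <;> rcases h2 with ⟨rfl, rfl⟩ | ⟨rfl, rfl⟩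
      · exact absurd hab (lt_irrefl _)
      · simp
      · exact absurd (hab.trans hab') (lt_irrefl _)
      · exact absurd hab (lt_irrefl _)
    have h := integral_sq_sum_prod_bitNoise he (fun a => φ (x a)) Q _ hinj
      (fun p => B.mixed p.2.1 p.2.2)
    have h' : ∀ y, ∑ p ∈ Q, B.mixed p.2.1 p.2.2 * (η (p.1.1, p.2.1) y * η (p.1.2, p.2.2) y) =
        ∑ p ∈ Q, B.mixed p.2.1 p.2.2 *
          ∏ j ∈ ({(p.1.1, p.2.1), (p.1.2, p.2.2)} : Finset (Fin n × ι)), η j y := fun y =>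
      Finset.sum_congr rfl fun p hp => by rw [Finset.prod_pair (hne p hp)]
    simp only [h']
    rw [h]
    have hV0 : ∀ i, 0 ≤ V i := fun i => (bitVariance_nonneg _).trans (hV i)
    have hmm : ∀ i l, 0 ≤ 4 * (M i * M l) := fun i l => (sq_nonneg _).trans (hm i l)
    calc _ ≤ ∑ p ∈ Q, 4 * (M p.2.1 * V p.2.1 * (M p.2.2 * V p.2.2)) := by
          refine Finset.sum_le_sum fun p hp => ?_
          rw [Finset.prod_pair (hne p hp)]
          calc _ ≤ 4 * (M p.2.1 * M p.2.2) * (V p.2.1 * V p.2.2) :=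
                mul_le_mul (hm _ _) (mul_le_mul (hV _) (hV _) (bitVariance_nonneg _) (hV0 _))
                  (mul_nonneg (bitVariance_nonneg _) (bitVariance_nonneg _)) (hmm _ _)
            _ = _ := by ring
      _ ≤ ∑ p : (Fin n × Fin n) × (ι × ι), 4 * (M p.2.1 * V p.2.1 * (M p.2.2 * V p.2.2)) := by
          refine Finset.sum_le_sum_of_subset_of_nonneg (Finset.subset_univ _) fun p _ _ => ?_
          have := mul_nonneg (hmm p.2.1 p.2.2) (mul_nonneg (hV0 p.2.1) (hV0 p.2.2))
          linarith
      _ = _ := by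
          rw [Fintype.sum_prod_type]
          simp only [Finset.sum_const, Finset.card_univ, Fintype.card_prod, Fintype.card_fin,
            nsmul_eq_mul, Nat.cast_mul]
          rw [← Finset.mul_sum, Fintype.sum_prod_type, sq (∑ i, M i * V i), Finset.sum_mul_sum]
          ring
  calc _ = ∫ y, (((n.choose 2 : ℕ) : ℝ)⁻¹ * (∑ j, linearCoeff φ B x j * η j y +
          ∑ p ∈ Q, B.mixed p.2.1 p.2.2 * (η (p.1.1, p.2.1) y * η (p.1.2, p.2.2) y))) ^ 2 ∂μ := by
        congr 1
        ext y
        rw [bitProtocol_estimate_eq φ e B x y, add_sub_cancel_left]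
    _ ≤ ∫ y, ((4 / (n : ℝ) ^ 2) ^ 2 * 2) * ((∑ j, linearCoeff φ B x j * η j y) ^ 2 +
          (∑ p ∈ Q, B.mixed p.2.1 p.2.2 *
            (η (p.1.1, p.2.1) y * η (p.1.2, p.2.2) y)) ^ 2) ∂μ := by
        refine integral_mono Integrable.of_finite Integrable.of_finite fun y => ?_
        simp only
        rw [mul_pow, mul_assoc]
        gcongr
        exact add_sq_le
    _ ≤ ((4 / (n : ℝ) ^ 2) ^ 2 * 2) * ((n : ℝ) ^ 3 * ∑ i, M i ^ 2 * V i +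
          4 * (n : ℝ) ^ 2 * (∑ i, M i * V i) ^ 2) := by
        rw [integral_const_mul, integral_add Integrable.of_finite Integrable.of_finite]
        gcongr
    _ = _ := by
        field_simp
        ring

end PairwiseLDP

/-! ### The dyadic protocol and the choice of depth -/

namespace PairwiseLDP

namespace DyadicNet

variable {k : ℕ} (N : DyadicNet k) (T : ℕ)

/-- The bits that describe the representatives of a point at the levels `1, …, T`. -/
def bits (v : Fin k) (i : Fin T × Fin k) : Bool := decide (N.rep (i.1 + 1) v = i.2)

/-- The coefficients of `f (N.rep T u) (N.rep T v)` as a biaffine function of the bits of `u`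
and `v`. -/
noncomputable def coeffs (f : Fin k → Fin k → ℝ) (x₀ : Fin k) : Biaffine (Fin T × Fin k) where
  const := f (N.rep 0 x₀) (N.rep 0 x₀)
  left i := N.detail (fun u => f u (N.rep 0 x₀)) i.1 i.2
  right l := N.detail (f (N.rep 0 x₀)) l.1 l.2
  mixed i l := N.detail (fun u => N.detail (f u) l.1 l.2) i.1 i.2

theorem apply_rep_eq_bits (g : Fin k → ℝ) (x₀ v : Fin k) :
    g (N.rep T v) = g (N.rep 0 x₀) +
      ∑ i : Fin T × Fin k, N.detail g i.1 i.2 * bitVal (N.bits T v i) := by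
  rw [N.apply_rep_eq g T v, N.rep_zero v x₀]
  simp [bits, bitVal]

/-- At the true bits of the other user, the sum over mixed coefficients collapses to one increment
of `f` in a single variable, so the Lipschitz bound applies with no loss over levels. -/
theorem slopeLeft_coeffs (f : Fin k → Fin k → ℝ) (x₀ v : Fin k) (i : Fin T × Fin k) :
    (N.coeffs T f x₀).slopeLeft (fun l => bitVal (N.bits T v l)) i =
      N.detail (fun u => f u (N.rep T v)) i.1 i.2 := by
  simp only [N.apply_rep_eq_bits T (f _) x₀ v, detail_add, detail_sum, detail_mul_const]
  rfl

theorem slopeRight_coeffs (f : Fin k → Fin k → ℝ) (x₀ u : Fin k) (l : Fin T × Fin k) :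
    (N.coeffs T f x₀).slopeRight (fun i => bitVal (N.bits T u i)) l =
      N.detail (f (N.rep T u)) l.1 l.2 := by
  have h : f (N.rep T u) = fun w => f (N.rep 0 x₀) w +
      ∑ i : Fin T × Fin k, N.detail (fun u => f u w) i.1 i.2 * bitVal (N.bits T u i) :=
    funext fun w => N.apply_rep_eq_bits T (fun u => f u w) x₀ u
  rw [h, detail_add, detail_sum]
  simp only [detail_mul_const, ← N.detail_comm f]
  rfl

theorem bitKernel_coeffs (f : Fin k → Fin k → ℝ) (x₀ u v : Fin k) :
    bitKernel (N.bits T) (N.coeffs T f x₀) u v = f (N.rep T u) (N.rep T v) := by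
  rw [N.apply_rep_eq_bits T (fun u => f u (N.rep T v)) x₀ u]
  simp only [← N.slopeLeft_coeffs T f x₀ v]
  rw [N.apply_rep_eq_bits T (f (N.rep 0 x₀)) x₀ v, bitKernel, Biaffine.eval]
  simp only [Biaffine.slopeLeft, add_mul, Finset.sum_add_distrib, Finset.sum_mul]
  have h : ∀ i l : Fin T × Fin k, (N.coeffs T f x₀).mixed i l * bitVal (N.bits T v l) *
      bitVal (N.bits T u i) = (N.coeffs T f x₀).mixed i l *
        (bitVal (N.bits T u i) * bitVal (N.bits T v l)) := fun i l => by ring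
  simp only [h]
  simp only [coeffs]
  ring

/-- At each level the bits form a one-hot vector, so two inputs disagree in at most two places. -/
theorem sum_bits_ne_le {c : ℕ → ℝ} (hc : ∀ t, 0 ≤ c t) (v v' : Fin k) :
    ∑ i : Fin T × Fin k, (if N.bits T v i = N.bits T v' i then 0 else c i.1) ≤
      ∑ t ∈ Finset.range T, 2 * c t := by
  rw [Fintype.sum_prod_type, ← Fin.sum_univ_eq_sum_range (fun t => 2 * c t)]
  refine Finset.sum_le_sum fun t _ => ?_
  calc _ ≤ ∑ p, ((if N.rep (t + 1) v = p then c t else 0) +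
        if N.rep (t + 1) v' = p then c t else 0) := by
        refine Finset.sum_le_sum fun p _ => ?_
        have := hc t
        by_cases h : N.rep (t + 1) v = p <;> by_cases h' : N.rep (t + 1) v' = p <;>
          simp [bits, h, h', this]
    _ = _ := by
        rw [Finset.sum_add_distrib]
        simp only [Finset.sum_ite_eq, Finset.mem_univ, if_true]
        ring

theorem sum_sq_detailBound_mul_le {B : ℝ} (hB : 0 ≤ B) (a : ℝ) (ha : 0 ≤ a) :
    ∑ i : Fin T × Fin k, N.detailBound B i.1 i.2 ^ 2 * (a * (25 / 16) ^ (i.1 : ℕ)) ≤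
      10 * a * B ^ 2 := by
  rw [Fintype.sum_prod_type]
  calc _ ≤ ∑ t : Fin T, 2 * a * B ^ 2 * (25 / 32) ^ (t : ℕ) := by
        refine Finset.sum_le_sum fun t _ => ?_
        simp only [← Finset.sum_mul]
        calc _ ≤ 2 ^ ((t : ℕ) + 1) * (B / 2 ^ (t : ℕ)) ^ 2 * (a * (25 / 16) ^ (t : ℕ)) := by
              gcongr
              exact N.sum_detailBound_pow_le hB t two_ne_zero
          _ = _ := by
              rw [show (25 / 32 : ℝ) = 25 / 16 / 2 by norm_num, div_pow (25 / 16 : ℝ) 2]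
              field_simp
              ring
    _ = 2 * a * B ^ 2 * ∑ t ∈ Finset.range T, (25 / 32) ^ t := by
        rw [← Finset.mul_sum, Fin.sum_univ_eq_sum_range (fun t => ((25 : ℝ) / 32) ^ t)]
    _ ≤ 2 * a * B ^ 2 * 5 := by
        gcongr
        exact (sum_range_geometric_le (by norm_num) (by norm_num) T).trans (by norm_num)
    _ = _ := by ring

/-- The number of cells cancels the decay of the increments, so the growth of the variance remains;
this is what forces truncation at a finite depth. -/
theorem sum_detailBound_mul_le {B : ℝ} (hB : 0 ≤ B) (a : ℝ) (ha : 0 ≤ a) :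
    ∑ i : Fin T × Fin k, N.detailBound B i.1 i.2 * (a * (25 / 16) ^ (i.1 : ℕ)) ≤
      2 * a * B * ∑ t ∈ Finset.range T, (25 / 16) ^ t := by
  rw [Fintype.sum_prod_type, Finset.mul_sum,
    ← Fin.sum_univ_eq_sum_range (fun t => 2 * a * B * (25 / 16 : ℝ) ^ t)]
  refine Finset.sum_le_sum fun t _ => ?_
  simp only [← Finset.sum_mul]
  calc _ ≤ 2 ^ ((t : ℕ) + 1) * (B / 2 ^ (t : ℕ)) ^ 1 * (a * (25 / 16) ^ (t : ℕ)) := by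
        gcongr
        simpa using N.sum_detailBound_pow_le hB t one_ne_zero
    _ = _ := by
        field_simp
        ring

end DyadicNet

/-- Take `4 ^ T ≤ z < 4 ^ (T + 1)`, or `T = 0` if `z < 1`. The square of the geometric sum is at
most `4 (625/256) ^ T`, and `625/256 < 4`. -/
theorem exists_sq_geom_sum_le {z : ℝ} (hz : 0 < z) :
    ∃ T : ℕ, (∑ t ∈ Finset.range T, (25 / 16 : ℝ) ^ t) ^ 2 ≤ 4 * z ∧ z ≤ 4 * 4 ^ T := by
  rcases lt_or_ge z 1 with h | h
  · exact ⟨0, by simp [hz.le], by norm_num; linarith⟩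
  · obtain ⟨T, h1, h2⟩ := exists_nat_pow_near h (by norm_num : (1 : ℝ) < 4)
    refine ⟨T, ?_, by rw [pow_succ] at h2; linarith⟩
    have hs : ∑ t ∈ Finset.range T, (25 / 16 : ℝ) ^ t ≤ 2 * (25 / 16) ^ T := by
      rw [geom_sum_eq (by norm_num), div_le_iff₀ (by norm_num)]
      have : (0 : ℝ) < (25 / 16) ^ T := by positivity
      linarith
    calc _ ≤ (2 * (25 / 16 : ℝ) ^ T) ^ 2 := by gcongr
      _ = 4 * (625 / 256 : ℝ) ^ T := by
          rw [mul_pow, ← pow_mul, mul_comm T 2, pow_mul]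
          norm_num
      _ ≤ 4 * 4 ^ T := by
          gcongr
          norm_num
      _ ≤ 4 * z := by linarith

theorem sq_pairwiseStatistic_sub_le {k n : ℕ} (hn : 2 ≤ n) {f g : Fin k → Fin k → ℝ} {δ : ℝ}
    (hδ : 0 ≤ δ) (h : ∀ u v, |f u v - g u v| ≤ δ) (x : Fin n → Fin k) :
    (pairwiseStatistic f x - pairwiseStatistic g x) ^ 2 ≤ 16 * δ ^ 2 := by
  have hn0 : (0 : ℝ) < n := by exact_mod_cast (by omega : 0 < n)
  have hle : |pairwiseStatistic f x - pairwiseStatistic g x| ≤ 4 * δ := by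
    rw [pairwiseStatistic, pairwiseStatistic, ← mul_sub, ← Finset.sum_sub_distrib, abs_mul,
      abs_of_nonneg (by positivity)]
    calc _ ≤ 4 / (n : ℝ) ^ 2 * ((n : ℝ) ^ 2 * δ) := by
          refine mul_le_mul (inv_choose_two_le hn) ?_ (abs_nonneg _) (by positivity)
          refine (Finset.abs_sum_le_sum_abs _ _).trans ?_
          refine (Finset.sum_le_sum fun p _ => h (x p.1) (x p.2)).trans ?_
          refine (Finset.sum_le_sum_of_subset_of_nonneg (Finset.filter_subset _ _)
            fun _ _ _ => hδ).trans ?_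
          simp [sq]
      _ = _ := by field_simp
  calc _ = |pairwiseStatistic f x - pairwiseStatistic g x| ^ 2 := (sq_abs _).symm
    _ ≤ (4 * δ) ^ 2 := by gcongr
    _ = _ := by ring

theorem exists_protocol_mse_le {k : ℕ} (hk : 1 ≤ k) {G : ℝ} (hG : 0 ≤ G) {f : Fin k → Fin k → ℝ}
    (hf : IsLipschitzKernel G f) {n : ℕ} (hn : 2 ≤ n) {ε : ℝ} (hε : 0 < ε) :
    ∃ P : Protocol k n, P.IsLocalDP ε ∧ ∀ x : Fin n → Fin k,
      P.mse x (pairwiseStatistic f x) ≤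
        ENNReal.ofReal (50000000 * (G ^ 2 * (k : ℝ) ^ 2 / (ε ^ 2 * n))) := by
  obtain ⟨N⟩ := nonempty_dyadicNet hk
  have hn0 : (0 : ℝ) < n := by exact_mod_cast (by omega : 0 < n)
  obtain ⟨T, hT, hT'⟩ := exists_sq_geom_sum_le (z := ε ^ 2 * n) (by positivity)
  have hB : 0 ≤ G * k := by positivity
  let x₀ : Fin k := ⟨0, hk⟩
  -- Two bits per level and `∑ (4/5)^t ≤ 5` give total budget at most `2 · (ε / 10) · 5 = ε`.
  let w : ℕ → ℝ := fun t => ε / 10 * (4 / 5) ^ t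
  have hw : ∀ t, 0 < w t := fun t => by positivity
  let e : Fin T × Fin k → ℝ := fun i => w i.1
  have he : ∀ i, 0 < e i := fun i => hw _
  let V : Fin T × Fin k → ℝ := fun i => 100 / ε ^ 2 * (25 / 16) ^ (i.1 : ℕ)
  have hV : ∀ i, bitVariance (e i) ≤ V i := by
    intro i
    refine (bitVariance_le (he i)).trans_eq ?_
    simp only [e, w, V]
    rw [mul_pow, ← pow_mul, mul_comm _ 2, pow_mul, show (25 / 16 : ℝ) = ((4 / 5) ^ 2)⁻¹ by norm_num,
      inv_pow]
    field_simp
    norm_num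
  let M : Fin T × Fin k → ℝ := fun i => N.detailBound (G * k) i.1 i.2
  have hbias : ∀ x : Fin n → Fin k, (pairwiseStatistic (bitKernel (N.bits T) (N.coeffs T f x₀)) x -
      pairwiseStatistic f x) ^ 2 ≤ 256 * ((G * k) ^ 2 / (ε ^ 2 * n)) := by
    intro x
    refine (sq_pairwiseStatistic_sub_le hn (δ := 2 * (G * k) / 2 ^ T) (by positivity)
      (fun u v => ?_) x).trans ?_
    · rw [N.bitKernel_coeffs]
      have h1 := hf.2 (N.rep T u) u (N.rep T v)
      have h2 := hf.1 u (N.rep T v) v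
      rw [abs_sub_comm ((N.rep T _ : ℕ) : ℝ)] at h1 h2
      have h3 := mul_le_mul_of_nonneg_left (N.abs_sub_rep_le T u) hG
      have h4 := mul_le_mul_of_nonneg_left (N.abs_sub_rep_le T v) hG
      refine (abs_sub_le _ (f u (N.rep T v)) _).trans ?_
      calc _ ≤ G * (k / 2 ^ T) + G * (k / 2 ^ T) := add_le_add (h1.trans h3) (h2.trans h4)
        _ = _ := by ring
    · have h4 : ((2 : ℝ) ^ T) ^ 2 = 4 ^ T := by
        rw [← pow_mul, mul_comm, pow_mul]; norm_num
      rw [div_pow, h4]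
      calc _ = 256 * ((G * k) ^ 2 / (4 * 4 ^ T)) := by ring
        _ ≤ _ := by gcongr
  refine ⟨bitProtocol k n (N.bits T) e (N.coeffs T f x₀),
    bitProtocol_isLocalDP (fun i => (he i).le) (fun v v' => ?_) _, fun x => ?_⟩
  · refine (N.sum_bits_ne_le T (c := w) (fun t => (hw t).le) v v').trans ?_
    simp only [w, ← mul_assoc]
    rw [← Finset.mul_sum]
    calc _ ≤ 2 * (ε / 10) * 5 := by
          gcongr
          exact (sum_range_geometric_le (by norm_num) (by norm_num) T).trans (by norm_num)
      _ = _ := by ring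
  · have hvar := integral_sq_bitProtocol_sub_le hn he (φ := N.bits T) (B := N.coeffs T f x₀) (M := M) hV
      (fun v i => by
        rw [N.slopeLeft_coeffs]
        exact N.abs_detail_le hG (fun u u' => hf.2 u u' _) _ _)
      (fun v i => by
        rw [N.slopeRight_coeffs]
        exact N.abs_detail_le hG (fun u u' => hf.1 _ u u') _ _)
      (fun i l => N.sq_detail_detail_le hG hf _ _ _ _) x
    have h1 := N.sum_sq_detailBound_mul_le T hB (100 / ε ^ 2) (by positivity)
    have h2 := N.sum_detailBound_mul_le T hB (100 / ε ^ 2) (by positivity)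
    have hvar' : 32 / n * ∑ i, M i ^ 2 * V i + 128 / (n : ℝ) ^ 2 * (∑ i, M i * V i) ^ 2 ≤
        20512000 * ((G * k) ^ 2 / (ε ^ 2 * n)) := by
      calc _ ≤ 32 / n * (10 * (100 / ε ^ 2) * (G * k) ^ 2) + 128 / (n : ℝ) ^ 2 *
            (2 * (100 / ε ^ 2) * (G * k) * ∑ t ∈ Finset.range T, (25 / 16) ^ t) ^ 2 := by
            have h0 : 0 ≤ ∑ i, M i * V i := Finset.sum_nonneg fun i _ =>
              mul_nonneg (N.detailBound_nonneg hB _ _) (by positivity)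
            gcongr
        _ ≤ 32 / n * (10 * (100 / ε ^ 2) * (G * k) ^ 2) + 128 / (n : ℝ) ^ 2 *
            ((2 * (100 / ε ^ 2) * (G * k)) ^ 2 * (4 * (ε ^ 2 * n))) := by
            rw [mul_pow _ (∑ t ∈ Finset.range T, (25 / 16 : ℝ) ^ t)]
            gcongr
        _ = _ := by
            field_simp
            ring
    set P := bitProtocol k n (N.bits T) e (N.coeffs T f x₀) with hP
    set z := pairwiseStatistic f x
    set z' := pairwiseStatistic (bitKernel (N.bits T) (N.coeffs T f x₀)) x
    set μ := Measure.pi fun a : Fin n => Measure.pi fun i => bitLaw (e i) (N.bits T (x a) i) with hμ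
    have hmse : P.mse x z = ENNReal.ofReal (∫ y, (P.estimate y - z) ^ 2 ∂μ) := by
      rw [ofReal_integral_eq_lintegral_ofReal Integrable.of_finite
        (Filter.Eventually.of_forall fun y => sq_nonneg _)]
      rfl
    rw [hmse]
    apply ENNReal.ofReal_le_ofReal
    calc _ ≤ ∫ y, (2 * (P.estimate y - z') ^ 2 + 2 * (z' - z) ^ 2) ∂μ := by
          refine integral_mono Integrable.of_finite Integrable.of_finite fun y => ?_
          simp only
          -- `(a + b)² ≤ 2a² + 2b²` separates variance from squared bias.
          nlinarith [sq_nonneg ((P.estimate y - z') - (z' - z))]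
      _ = 2 * ∫ y, (P.estimate y - z') ^ 2 ∂μ + 2 * (z' - z) ^ 2 := by
          rw [integral_add Integrable.of_finite Integrable.of_finite, integral_const_mul,
            integral_const, probReal_univ, one_smul]
      _ ≤ 2 * (20512000 * ((G * k) ^ 2 / (ε ^ 2 * n))) +
            2 * (256 * ((G * k) ^ 2 / (ε ^ 2 * n))) := by
          gcongr
          · exact hvar.trans hvar'
          · exact hbias x
      _ ≤ _ := by
          rw [← mul_pow]
          have : 0 ≤ (G * k) ^ 2 / (ε ^ 2 * n) := by positivity
          linarith

end PairwiseLDP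

theorem mainTheorem8 :
    ∃ C : ℝ, 0 < C ∧
      ∀ (k : ℕ), 1 ≤ k → ∀ (G : ℝ), 0 ≤ G → ∀ (f : Fin k → Fin k → ℝ),
        PairwiseLDP.IsLipschitzKernel G f →
        -- the factorization norm of a kernel that is normalized by `|f| ≤ G k`
        ((∀ i j, |f i j| ≤ G * k) →
          PairwiseLDP.gammaTwo (PairwiseLDP.kernelMatrix f) ≤ C * (G * k)) ∧
        -- every kernel is so normalized by the subtraction of some constant
        (∃ c : ℝ, (∀ i j, |f i j - c| ≤ G * k) ∧
          PairwiseLDP.gammaTwo (PairwiseLDP.kernelMatrix fun i j => f i j - c) ≤ C * (G * k)) ∧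
        -- the protocol for the pairwise statistic (no normalization of `f`)
        (PairwiseLDP.IsSymmKernel f →
          ∀ (n : ℕ), 2 ≤ n → ∀ (ε : ℝ), 0 < ε →
            ∃ P : PairwiseLDP.Protocol k n, P.IsLocalDP ε ∧
              ∀ x : Fin n → Fin k,
                P.mse x (PairwiseLDP.pairwiseStatistic f x) ≤
                  ENNReal.ofReal (C * (G ^ 2 * (k : ℝ) ^ 2 * Real.log k / (ε ^ 2 * n)))) := by
  refine ⟨100000000, by norm_num, fun k hk G hG f hf => ⟨fun hb => ?_, ?_, fun _ n hn ε hε => ?_⟩⟩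
  · refine (PairwiseLDP.gammaTwo_kernelMatrix_le hk hG hf hb).trans ?_
    gcongr
    norm_num
  · have hc := hf.abs_sub_apply_middle_le hk hG
    refine ⟨_, hc, (PairwiseLDP.gammaTwo_kernelMatrix_le hk hG (hf.sub_const _) hc).trans ?_⟩
    gcongr
    norm_num
  · rcases hk.eq_or_lt with rfl | hk2
    -- For `k = 1` the target is zero because `log 1 = 0`; the kernel is constant, so the bound is
    -- applied with Lipschitz constant `0`.
    · have hf0 : PairwiseLDP.IsLipschitzKernel 0 f :=
        ⟨fun i j j' => by simp [Subsingleton.elim j j'],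
          fun i i' j => by simp [Subsingleton.elim i i']⟩
      obtain ⟨P, hP, h⟩ := PairwiseLDP.exists_protocol_mse_le le_rfl le_rfl hf0 hn hε
      exact ⟨P, hP, fun x => (h x).trans (by simp)⟩
    · obtain ⟨P, hP, h⟩ := PairwiseLDP.exists_protocol_mse_le hk hG hf hn hε
      refine ⟨P, hP, fun x => (h x).trans (ENNReal.ofReal_le_ofReal ?_)⟩
      have hlog : 1 / 2 ≤ Real.log k := by
        have h2 : (2 : ℝ) ≤ k := by exact_mod_cast hk2
        have := Real.log_le_log (by norm_num) h2
        linarith [Real.log_two_gt_d9]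
      calc (50000000 : ℝ) * (G ^ 2 * (k : ℝ) ^ 2 / (ε ^ 2 * n)) =
            100000000 * (G ^ 2 * (k : ℝ) ^ 2 * (1 / 2) / (ε ^ 2 * n)) := by ring
        _ ≤ _ := by gcongr
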